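/- For each integer $Q\ge 1$ let $\mathcal S_Q$ be the set of matrices $\begin{pmatrix} a & b\\ c& d\end{pmatrix}\in \mathrm{SL}(2,\mathbb Z)$ with $a\ge b\ge d\ge 1$, $a\ge c\ge d$ and trace $a+d\le Q$, and let $$\mathfrak{SF}_Q:=\left\{\frac db : \begin{pmatrix} a & b\\ c& d\end{pmatrix}\in\mathcal S_Q\right\}\subset \mathbb Q\cap(0,1]$$ be the (finite) set of $\mathrm{SL}(2,\mathbb N)$-saturated Farey fractions of order $Q$, each fraction being counted once. Then for every $\beta\in[0,1]$, $$\lim_{Q\to\infty}\frac{\#\big(\mathfrak{SF}_Q\cap[0,\beta]\big)}{\#\mathfrak{SF}_Q}=\int_0^\beta\left(\frac1{1+x}-\frac1{2+x}\right)\frac{dx}{\log(4/3)} .$$ -/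

import Mathlib

open Matrix Filter Topology

/-- The monoid `𝒮` of matrices `(a b; c d) ∈ SL(2, ℤ)` with `a ≥ b ≥ d ≥ 1` and `a ≥ c ≥ d`. -/
def monoidS : Set (Matrix.SpecialLinearGroup (Fin 2) ℤ) :=
  {M | M.1 0 0 ≥ M.1 0 1 ∧ M.1 0 1 ≥ M.1 1 1 ∧ M.1 1 1 ≥ 1 ∧
    M.1 0 0 ≥ M.1 1 0 ∧ M.1 1 0 ≥ M.1 1 1}

/-- The matrices in `𝒮` of trace at most `Q`. -/
def traceS (Q : ℕ) : Set (Matrix.SpecialLinearGroup (Fin 2) ℤ) :=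
  {M | M ∈ monoidS ∧ M.1.trace ≤ (Q : ℤ)}

/-- The map `Ψ` sending `(a b; c d)` to the fraction `d / b`. -/
def fracPsi (M : Matrix.SpecialLinearGroup (Fin 2) ℤ) : ℚ :=
  (M.1 1 1 : ℚ) / (M.1 0 1 : ℚ)

/-- The set `𝔖𝔉_Q = Ψ(𝒮_Q)` of saturated Farey fractions of order `Q`. -/
def saturatedFarey (Q : ℕ) : Set ℚ := fracPsi '' traceS Q

/-- The set `𝔖𝔉_Q` is finite, so that counting its elements is meaningful. -/
theorem saturatedFarey_finite (Q : ℕ) : (saturatedFarey Q).Finite := by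
  refine (((Set.finite_Icc (1 : ℤ) Q).prod (Set.finite_Icc (1 : ℤ) Q)).image
    (fun p : ℤ × ℤ => (p.1 : ℚ) / (p.2 : ℚ))).subset ?_
  rintro _ ⟨M, ⟨⟨h1, h2, h3, h4, h5⟩, ht⟩, rfl⟩
  rw [Matrix.trace_fin_two] at ht
  refine ⟨(M.1 1 1, M.1 0 1), ⟨⟨?_, ?_⟩, ⟨?_, ?_⟩⟩, rfl⟩ <;> dsimp only <;> omega

/-!
For `(a b; c d)` in `𝒮`, the number `a - b` is a positive inverse of `d` modulo `b`. The least
possible trace over the fraction `d / b` is therefore `b + d + d̄`, where `d̄` is the inverse of `d`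
modulo `b` in `{1, …, b}`, so counting saturated Farey fractions up to `β` amounts to counting
coprime pairs `d ≤ b` with `d / b ≤ β` and `b (1 + d / b + d̄ / b) ≤ Q`.

The points `(d / b, d̄ / b)` with `b ≤ X` are equidistributed in the unit square: by Weyl's
criterion this reduces to cancellation in Kloosterman sums modulo `b` on average over `b`. No
square-root cancellation is needed. Kloosterman's elementary fourth moment bound saves a power of a
prime exactly dividing `b`, and all but a small proportion of the moduli have a large such prime
factor.

Since about `3 X² / π²` coprime pairs have `b ≤ X`, cutting the square into slices on which
`1 + x + y` is nearly constant shows that the count is asymptotic to `3 Q² / π²` times the integral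
of `(1 + x + y)⁻²` over the part `x ≤ β` of the square, and integrating over `y` first gives
`1 / (1 + x) - 1 / (2 + x)`.
-/

section Kloosterman

/-- The Kloosterman sum of an additive character `χ` of `R × R`, that is, the exponential sum over
the hyperbola `x y = 1`. The classical sum with frequencies `a` and `b` is the one of
`χ (x, y) = ψ (a x + b y)`. -/
noncomputable def kloostermanSum {R : Type*} [CommRing R] [Fintype Rˣ]
    (χ : AddChar (R × R) ℂ) : ℂ :=
  ∑ u : Rˣ, χ (u, (u⁻¹ : Rˣ))

theorem norm_kloostermanSum_le_card_units {R : Type*} [CommRing R] [Finite R] [Fintype Rˣ]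
    (χ : AddChar (R × R) ℂ) : ‖kloostermanSum χ‖ ≤ Fintype.card Rˣ := by
  refine (norm_sum_le _ _).trans ?_
  simp [AddChar.norm_apply]

/-- The character `(x, y) ↦ χ (t x, t⁻¹ y)`, the image of `χ` under the torus preserving the
hyperbola `x y = 1`. -/
def hyperbolicTwist {R : Type*} [CommRing R] (χ : AddChar (R × R) ℂ) (t : Rˣ) :
    AddChar (R × R) ℂ :=
  χ.compAddMonoidHom ((AddMonoidHom.mulLeft (t : R)).prodMap (AddMonoidHom.mulLeft ↑t⁻¹))

theorem kloostermanSum_hyperbolicTwist {R : Type*} [CommRing R] [Fintype Rˣ]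
    (χ : AddChar (R × R) ℂ) (t : Rˣ) :
    kloostermanSum (hyperbolicTwist χ t) = kloostermanSum χ := by
  refine Fintype.sum_equiv (Equiv.mulLeft t) _ _ fun u => ?_
  simp [hyperbolicTwist, mul_comm]

theorem hyperbolicTwist_injective {F : Type*} [Field F] {χ : AddChar (F × F) ℂ} (hχ : χ ≠ 1) :
    Function.Injective (hyperbolicTwist χ) := by
  intro s t hst
  by_contra hne
  have heq (x y : F) : χ (s * x, (s : F)⁻¹ * y) = χ (t * x, (t : F)⁻¹ * y) := by
    simpa [hyperbolicTwist] using DFunLike.congr_fun hst (x, y)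
  have hsub (a b : F × F) (h : χ a = χ b) : χ (a - b) = 1 := by
    rw [sub_eq_add_neg, AddChar.map_add_eq_mul, h, ← AddChar.map_add_eq_mul, add_neg_cancel,
      AddChar.map_zero_eq_one]
  have hfst (x : F) : χ (x, 0) = 1 := by
    have hd : (s : F) - t ≠ 0 := sub_ne_zero.2 (Units.val_injective.ne hne)
    have := hsub _ _ (heq (((s : F) - t)⁻¹ * x) 0)
    rwa [Prod.mk_sub_mk, mul_zero, mul_zero, sub_zero, ← sub_mul, mul_inv_cancel_left₀ hd] at this
  have hsnd (y : F) : χ (0, y) = 1 := by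
    have hd : (s : F)⁻¹ - (t : F)⁻¹ ≠ 0 :=
      sub_ne_zero.2 (inv_injective.ne (Units.val_injective.ne hne))
    have := hsub _ _ (heq 0 (((s : F)⁻¹ - (t : F)⁻¹)⁻¹ * y))
    rwa [Prod.mk_sub_mk, mul_zero, mul_zero, sub_zero, ← sub_mul, mul_inv_cancel_left₀ hd] at this
  refine hχ (DFunLike.ext _ _ fun z => ?_)
  rw [AddChar.one_apply, ← Prod.fst_add_snd z, AddChar.map_add_eq_mul, hfst, hsnd, one_mul]

theorem sum_norm_sq_sum_addChar {A ι : Type*} [AddCommGroup A] [Fintype A] [DecidableEq A]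
    [Fintype ι] (v : ι → A) :
    ∑ χ : AddChar A ℂ, ‖∑ i, χ (v i)‖ ^ 2 =
      Fintype.card A * (Finset.univ.filter fun p : ι × ι => v p.1 = v p.2).card := by
  have hexpand (χ : AddChar A ℂ) :
      ((‖∑ i, χ (v i)‖ ^ 2 : ℝ) : ℂ) = ∑ p : ι × ι, χ (v p.1 - v p.2) := by
    rw [Complex.ofReal_pow, ← Complex.mul_conj', map_sum, Finset.sum_mul_sum,
      ← Fintype.sum_prod_type']
    simp only [sub_eq_add_neg, AddChar.map_add_eq_mul, AddChar.map_neg_eq_conj]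
  apply Complex.ofReal_injective
  simp only [Complex.ofReal_sum, hexpand]
  rw [Finset.sum_comm]
  simp only [AddChar.sum_apply_eq_ite, sub_eq_zero, Finset.sum_ite, Finset.sum_const_zero, add_zero,
    Finset.sum_const, nsmul_eq_mul]
  push_cast
  ring

section Field

variable {F : Type*} [Field F]

theorem units_eq_or_eq_or_eq_neg_of_add_eq_add {u v w z : Fˣ} (hadd : (u : F) + v = w + z)
    (hinv : (u : F)⁻¹ + (v : F)⁻¹ = (w : F)⁻¹ + (z : F)⁻¹) :
    (u = w ∧ v = z) ∨ (u = z ∧ v = w) ∨ (v = -u ∧ z = -w) := by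
  have hprod : ((u : F) + v) * (u * v - w * z) = 0 := by
    field_simp at hinv
    linear_combination ((u : F) * v) * hadd - hinv
  simp only [← Units.val_inj, Units.val_neg]
  rcases mul_eq_zero.1 hprod with hneg | hmul
  · exact .inr (.inr ⟨by linear_combination hneg, by linear_combination hneg - hadd⟩)
  · have hroot : ((u : F) - w) * (u - z) = 0 := by linear_combination (u : F) * hadd - hmul
    rcases mul_eq_zero.1 hroot with h | h
    · exact .inl ⟨by linear_combination h, by linear_combination hadd - h⟩
    · exact .inr (.inl ⟨by linear_combination h, by linear_combination hadd - h⟩)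

variable [Fintype F] [DecidableEq F]

theorem card_hyperbola_energy_le :
    (Finset.univ.filter fun p : (Fˣ × Fˣ) × (Fˣ × Fˣ) =>
      (((p.1.1 : F) + p.1.2, (p.1.1 : F)⁻¹ + (p.1.2 : F)⁻¹) : F × F) =
        ((p.2.1 : F) + p.2.2, (p.2.1 : F)⁻¹ + (p.2.2 : F)⁻¹)).card ≤
      3 * Fintype.card Fˣ ^ 2 := by
  let diagonal : Fˣ × Fˣ → (Fˣ × Fˣ) × (Fˣ × Fˣ) := fun u => (u, u)
  let swapped : Fˣ × Fˣ → (Fˣ × Fˣ) × (Fˣ × Fˣ) := fun u => (u, (u.2, u.1))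
  let opposite : Fˣ × Fˣ → (Fˣ × Fˣ) × (Fˣ × Fˣ) := fun u => ((u.1, -u.1), (u.2, -u.2))
  have hcard (f : Fˣ × Fˣ → (Fˣ × Fˣ) × (Fˣ × Fˣ)) :
      (Finset.univ.image f).card ≤ Fintype.card Fˣ ^ 2 :=
    Finset.card_image_le.trans (by simp [sq])
  calc _ ≤ (Finset.univ.image diagonal ∪
        (Finset.univ.image swapped ∪ Finset.univ.image opposite)).card := by
        refine Finset.card_le_card ?_
        rintro ⟨⟨u, v⟩, ⟨w, z⟩⟩ h
        simp only [Finset.mem_filter, Finset.mem_univ, true_and, Prod.mk.injEq] at h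
        simp only [Finset.mem_union, Finset.mem_image, Finset.mem_univ, true_and, Prod.exists,
          diagonal, swapped, opposite, Prod.mk.injEq]
        rcases units_eq_or_eq_or_eq_neg_of_add_eq_add h.1 h.2 with
          ⟨rfl, rfl⟩ | ⟨rfl, rfl⟩ | ⟨rfl, rfl⟩
        exacts [.inl ⟨u, v, by simp⟩, .inr (.inl ⟨u, v, by simp⟩), .inr (.inr ⟨u, w, by simp⟩)]
    _ ≤ Fintype.card Fˣ ^ 2 + (Fintype.card Fˣ ^ 2 + Fintype.card Fˣ ^ 2) :=
        (Finset.card_union_le _ _).trans (add_le_add (hcard _)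
          ((Finset.card_union_le _ _).trans (add_le_add (hcard _) (hcard _))))
    _ = 3 * Fintype.card Fˣ ^ 2 := by ring

theorem sum_norm_kloostermanSum_pow_four_le :
    ∑ χ : AddChar (F × F) ℂ, ‖kloostermanSum χ‖ ^ 4 ≤
      3 * (Fintype.card F : ℝ) ^ 2 * (Fintype.card Fˣ : ℝ) ^ 2 := by
  let v : Fˣ × Fˣ → F × F := fun p => ((p.1 : F) + p.2, (p.1 : F)⁻¹ + (p.2 : F)⁻¹)
  have hsq (χ : AddChar (F × F) ℂ) : ‖kloostermanSum χ‖ ^ 4 = ‖∑ p, χ (v p)‖ ^ 2 := by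
    rw [show (4 : ℕ) = 2 * 2 from rfl, pow_mul, ← norm_pow, kloostermanSum, sq (∑ u : Fˣ, _),
      Finset.sum_mul_sum, ← Fintype.sum_prod_type']
    simp only [← AddChar.map_add_eq_mul, Prod.mk_add_mk, Units.val_inv_eq_inv_val, v]
  calc ∑ χ : AddChar (F × F) ℂ, ‖kloostermanSum χ‖ ^ 4
      = Fintype.card (F × F) *
          ((Finset.univ.filter fun p : (Fˣ × Fˣ) × (Fˣ × Fˣ) => v p.1 = v p.2).card : ℝ) := by
        simp only [hsq, sum_norm_sq_sum_addChar]
    _ ≤ Fintype.card (F × F) * (3 * Fintype.card Fˣ ^ 2 : ℕ) := by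
        gcongr
        exact card_hyperbola_energy_le
    _ = 3 * (Fintype.card F : ℝ) ^ 2 * (Fintype.card Fˣ : ℝ) ^ 2 := by
        rw [Fintype.card_prod]
        push_cast
        ring

-- All the twists of `χ` are distinct and have the same sum, so it occurs `|Fˣ|` times in the
-- fourth moment.
theorem norm_kloostermanSum_pow_four_le {χ : AddChar (F × F) ℂ} (hχ : χ ≠ 1) :
    ‖kloostermanSum χ‖ ^ 4 ≤ 3 * (Fintype.card F : ℝ) ^ 3 := by
  have horbit : (Fintype.card Fˣ : ℝ) * ‖kloostermanSum χ‖ ^ 4 ≤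
      ∑ χ : AddChar (F × F) ℂ, ‖kloostermanSum χ‖ ^ 4 := by
    calc (Fintype.card Fˣ : ℝ) * ‖kloostermanSum χ‖ ^ 4
        = ∑ t : Fˣ, ‖kloostermanSum (hyperbolicTwist χ t)‖ ^ 4 := by
          simp only [kloostermanSum_hyperbolicTwist, Finset.sum_const, Finset.card_univ,
            nsmul_eq_mul]
      _ = ∑ χ' ∈ Finset.univ.map ⟨hyperbolicTwist χ, hyperbolicTwist_injective hχ⟩,
            ‖kloostermanSum χ'‖ ^ 4 := by
          rw [Finset.sum_map, Function.Embedding.coeFn_mk]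
      _ ≤ _ := Finset.sum_le_sum_of_subset_of_nonneg (Finset.subset_univ _)
          fun _ _ _ => by positivity
  have hunits : (Fintype.card Fˣ : ℝ) ≤ Fintype.card F := by
    exact_mod_cast Fintype.card_le_of_injective _ (Units.val_injective (α := F))
  have hpos : (0 : ℝ) < Fintype.card Fˣ := by exact_mod_cast Fintype.card_pos
  refine le_of_mul_le_mul_left ?_ hpos
  calc _ ≤ 3 * (Fintype.card F : ℝ) ^ 2 * (Fintype.card Fˣ : ℝ) ^ 2 :=
        horbit.trans sum_norm_kloostermanSum_pow_four_le
    _ = Fintype.card Fˣ * (3 * (Fintype.card F : ℝ) ^ 2 * Fintype.card Fˣ) := by ring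
    _ ≤ Fintype.card Fˣ * (3 * (Fintype.card F : ℝ) ^ 2 * Fintype.card F) := by gcongr
    _ = _ := by ring

end Field

section Ring

variable {R S : Type*} [CommRing R] [CommRing S] [Fintype Rˣ] [Fintype Sˣ]

theorem kloostermanSum_prod [Fintype (R × S)ˣ] (χ : AddChar ((R × S) × (R × S)) ℂ) :
    kloostermanSum χ =
      kloostermanSum (χ.compAddMonoidHom ((AddMonoidHom.inl R S).prodMap (AddMonoidHom.inl R S))) *
      kloostermanSum
        (χ.compAddMonoidHom ((AddMonoidHom.inr R S).prodMap (AddMonoidHom.inr R S))) := by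
  unfold kloostermanSum
  rw [Finset.sum_mul_sum, ← Fintype.sum_prod_type']
  refine Fintype.sum_equiv MulEquiv.prodUnits.toEquiv _ _ fun u => ?_
  simp [MulEquiv.prodUnits, ← AddChar.map_add_eq_mul]

theorem kloostermanSum_compAddMonoidHom_ringEquiv (e : R ≃+* S) (χ : AddChar (S × S) ℂ) :
    kloostermanSum (χ.compAddMonoidHom ((e : R →+ S).prodMap (e : R →+ S))) =
      kloostermanSum χ := by
  refine Fintype.sum_equiv (Units.mapEquiv e.toMulEquiv).toEquiv _ _ fun u => ?_
  simp [← map_inv]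

end Ring

theorem norm_kloostermanSum_prod_pow_four_mul_card_le {F R : Type*} [Field F] [Fintype F]
    [CommRing R] [Fintype R] [Fintype (F × R)ˣ] {χ : AddChar ((F × R) × (F × R)) ℂ}
    (hχ : χ.compAddMonoidHom ((AddMonoidHom.inl F R).prodMap (AddMonoidHom.inl F R)) ≠ 1) :
    ‖kloostermanSum χ‖ ^ 4 * Fintype.card F ≤ 3 * (Fintype.card F * Fintype.card R : ℝ) ^ 4 := by
  classical
  rw [kloostermanSum_prod, norm_mul, mul_pow]
  have hunits : (Fintype.card Rˣ : ℝ) ≤ Fintype.card R := by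
    exact_mod_cast Fintype.card_le_of_injective _ (Units.val_injective (α := R))
  calc _ ≤ 3 * (Fintype.card F : ℝ) ^ 3 * (Fintype.card R : ℝ) ^ 4 * Fintype.card F := by
        gcongr
        · exact norm_kloostermanSum_pow_four_le hχ
        · exact (norm_kloostermanSum_le_card_units _).trans hunits
    _ = _ := by ring

/-- The additive character `(x, y) ↦ exp (2πi (m x + n y) / q)` of `(ℤ/q)²`. -/
noncomputable def zmodPairChar (q : ℕ) [NeZero q] (m n : ℤ) : AddChar (ZMod q × ZMod q) ℂ :=
  (ZMod.stdAddChar (N := q)).compAddMonoidHom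
    ((AddMonoidHom.mulLeft (m : ZMod q)).coprod (AddMonoidHom.mulLeft (n : ZMod q)))

theorem norm_kloostermanSum_zmodPairChar_mul_le {p r : ℕ} [NeZero r] [NeZero (p * r)]
    (hp : p.Prime) (hpr : p.Coprime r) {m n : ℤ} (hmn : ¬ ((p : ℤ) ∣ m ∧ (p : ℤ) ∣ n)) :
    ‖kloostermanSum (zmodPairChar (p * r) m n)‖ ^ 4 * p ≤ 3 * (p * r : ℝ) ^ 4 := by
  have : Fact p.Prime := ⟨hp⟩
  let e := (ZMod.chineseRemainder hpr).symm
  have hdvd (k : ℤ) (h : ZMod.stdAddChar (N := p * r) (k * e (1, 0)) = 1) : (p : ℤ) ∣ k := by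
    have hzero : e ((k : ZMod p × ZMod r) * (1, 0)) = e 0 := by
      rw [map_mul, map_intCast, map_zero]
      exact ZMod.injective_stdAddChar (h.trans (AddChar.map_zero_eq_one _).symm)
    have hfst := congrArg Prod.fst (e.injective hzero)
    rwa [Prod.fst_mul, Prod.fst_intCast, mul_one, Prod.fst_zero,
      ZMod.intCast_zmod_eq_zero_iff_dvd] at hfst
  rw [← kloostermanSum_compAddMonoidHom_ringEquiv e]
  have hbound := norm_kloostermanSum_prod_pow_four_mul_card_le (R := ZMod r) (F := ZMod p)
    (χ := (zmodPairChar (p * r) m n).compAddMonoidHom ((e : _ →+ _).prodMap (e : _ →+ _)))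
    fun h => hmn ⟨hdvd m ?_, hdvd n ?_⟩
  · simpa only [ZMod.card] using hbound
  · simpa [zmodPairChar, Prod.mk_zero_zero] using DFunLike.congr_fun h (1, 0)
  · simpa [zmodPairChar, Prod.mk_zero_zero] using DFunLike.congr_fun h (0, 1)

theorem exists_norm_kloostermanSum_zmodPairChar_le_mul {m n : ℤ} (hmn : m ≠ 0 ∨ n ≠ 0)
    {ε : ℝ} (hε : 0 < ε) :
    ∃ P : ℕ, ∀ (q p : ℕ) [NeZero q], p.Prime → P < p → p ∣ q → ¬p ^ 2 ∣ q →
      ‖kloostermanSum (zmodPairChar q m n)‖ ≤ ε * q := by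
  obtain ⟨P, hP⟩ := exists_nat_gt (max (3 / ε ^ 4) (max |(m : ℝ)| |(n : ℝ)|))
  simp only [max_lt_iff] at hP
  obtain ⟨hPε, hPm, hPn⟩ := hP
  refine ⟨P, fun q p _ hp hPp hpq hpq₂ => ?_⟩
  obtain ⟨r, rfl⟩ := hpq
  have : NeZero r := ⟨right_ne_zero_of_mul (NeZero.ne (p * r))⟩
  have hPp' : (P : ℝ) < p := by exact_mod_cast hPp
  have hpr : p.Coprime r := hp.coprime_iff_not_dvd.2 fun h =>
    hpq₂ (sq p ▸ Nat.mul_dvd_mul_left p h)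
  have hzero (k : ℤ) (hk : |(k : ℝ)| < P) (hpk : (p : ℤ) ∣ k) : k = 0 :=
    Int.eq_zero_of_abs_lt_dvd hpk (by exact_mod_cast hk.trans hPp')
  have hndvd : ¬((p : ℤ) ∣ m ∧ (p : ℤ) ∣ n) := fun h =>
    hmn.elim (fun hm => hm (hzero m hPm h.1)) fun hn => hn (hzero n hPn h.2)
  have hε₃ : 3 ≤ ε ^ 4 * p := by
    rw [← div_le_iff₀' (by positivity)]
    exact (hPε.trans hPp').le
  have hp₀ : (0 : ℝ) < p := by exact_mod_cast hp.pos
  refine le_of_pow_le_pow_left₀ four_ne_zero (by positivity) (le_of_mul_le_mul_right ?_ hp₀)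
  calc ‖kloostermanSum (zmodPairChar (p * r) m n)‖ ^ 4 * p ≤ 3 * (p * r : ℝ) ^ 4 :=
        norm_kloostermanSum_zmodPairChar_mul_le hp hpr hndvd
    _ ≤ ε ^ 4 * p * (p * r : ℝ) ^ 4 := by gcongr
    _ = (ε * (p * r : ℕ)) ^ 4 * p := by push_cast; ring

end Kloosterman

section Sieve

open Classical in
theorem card_filter_exists_sq_dvd_le {P : ℕ} (hP : P ≠ 0) (X : ℕ) :
    (((Finset.Ioc 0 X).filter fun q => ∃ p, P < p ∧ p ^ 2 ∣ q).card : ℝ) ≤ X / P := by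
  have hcover : ((Finset.Ioc 0 X).filter fun q => ∃ p, P < p ∧ p ^ 2 ∣ q) ⊆
      (Finset.Ioc P X).biUnion fun p => (Finset.Ioc 0 X).filter fun q => p ^ 2 ∣ q := by
    intro q hq
    simp only [Finset.mem_filter, Finset.mem_Ioc, Finset.mem_biUnion] at hq ⊢
    obtain ⟨⟨hq0, hqX⟩, p, hp, hpq⟩ := hq
    exact ⟨p, ⟨hp, ((Nat.le_self_pow two_ne_zero p).trans (Nat.le_of_dvd hq0 hpq)).trans hqX⟩,
      ⟨hq0, hqX⟩, hpq⟩
  calc (((Finset.Ioc 0 X).filter fun q => ∃ p, P < p ∧ p ^ 2 ∣ q).card : ℝ)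
      ≤ ∑ p ∈ Finset.Ioc P X, (X : ℝ) * ((p : ℝ) ^ 2)⁻¹ := by
        refine (Nat.cast_le.2 ((Finset.card_le_card hcover).trans Finset.card_biUnion_le)).trans ?_
        push_cast
        refine Finset.sum_le_sum fun p _ => ?_
        rw [Nat.Ioc_filter_dvd_card_eq_div, ← div_eq_mul_inv]
        exact_mod_cast Nat.cast_div_le (α := ℝ) (m := X) (n := p ^ 2)
    _ ≤ X / P := by
        rw [← Finset.mul_sum, div_eq_mul_inv]
        gcongr
        rcases le_or_gt P X with h | h
        · exact (sum_Ioc_inv_sq_le_sub hP h).trans (by simp)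
        · simp [Finset.Ioc_eq_empty (not_lt.2 h.le)]

open Classical in
theorem card_filter_forall_prime_sq_dvd_le {P : ℕ} (hP : P ≠ 0) (X : ℕ) :
    (((Finset.Ioc 0 X).filter fun q => ∀ p : ℕ, p.Prime → P < p → p ∣ q → p ^ 2 ∣ q).card : ℝ) ≤
      X / P + 2 ^ (P + 1).primesBelow.card * √X := by
  have hsub : ((Finset.Ioc 0 X).filter fun q => ∀ p : ℕ, p.Prime → P < p → p ∣ q → p ^ 2 ∣ q) ⊆
      ((Finset.Ioc 0 X).filter fun q => ∃ p, P < p ∧ p ^ 2 ∣ q) ∪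
        X.smoothNumbersUpTo (P + 1) := by
    intro q hq
    simp only [Finset.mem_union, Finset.mem_filter, Nat.mem_smoothNumbersUpTo,
      Nat.mem_smoothNumbers'] at hq ⊢
    by_contra! h
    obtain ⟨p, hp, hpq, hPp⟩ := h.2 (Finset.mem_Ioc.1 hq.1).2
    exact h.1 hq.1 p hPp (hq.2 p hp hPp hpq)
  have hsmooth : ((X.smoothNumbersUpTo (P + 1)).card : ℝ) ≤
      2 ^ (P + 1).primesBelow.card * √X := by
    refine (Nat.cast_le.2 (Nat.smoothNumbersUpTo_card_le X (P + 1))).trans ?_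
    push_cast
    gcongr
    exact Real.nat_sqrt_le_real_sqrt
  calc _ ≤ (((Finset.Ioc 0 X).filter fun q => ∃ p, P < p ∧ p ^ 2 ∣ q).card : ℝ) +
        (X.smoothNumbersUpTo (P + 1)).card := by
        exact_mod_cast (Finset.card_le_card hsub).trans (Finset.card_union_le _ _)
    _ ≤ _ := add_le_add (card_filter_exists_sq_dvd_le hP X) hsmooth

open Classical in
theorem exists_eventually_card_filter_forall_prime_sq_dvd_le {ε : ℝ} (hε : 0 < ε) :
    ∃ P₀ : ℕ, ∀ P ≥ P₀, ∀ᶠ X : ℕ in atTop,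
      (((Finset.Ioc 0 X).filter fun q => ∀ p : ℕ, p.Prime → P < p → p ∣ q → p ^ 2 ∣ q).card : ℝ) ≤
        ε * X := by
  obtain ⟨P₀, hP₀⟩ := exists_nat_gt (2 / ε)
  refine ⟨P₀, fun P hP => ?_⟩
  have hP : 2 / ε < P := hP₀.trans_le (by exact_mod_cast hP)
  have hP0 : (0 : ℝ) < P := lt_trans (by positivity) hP
  set D : ℝ := 2 ^ (P + 1).primesBelow.card
  filter_upwards [(tendsto_natCast_atTop_atTop (R := ℝ)).eventually_ge_atTop ((2 * D / ε) ^ 2)]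
    with X hX
  have hsquare : (X : ℝ) / P ≤ ε / 2 * X := by
    rw [div_lt_iff₀ hε] at hP
    rw [div_le_iff₀ hP0]
    nlinarith [(Nat.cast_nonneg X : (0 : ℝ) ≤ X)]
  have hsmooth : D * √X ≤ ε / 2 * X := by
    have hD : D ≤ ε / 2 * √X := by
      have := Real.le_sqrt_of_sq_le hX
      rw [div_le_iff₀ hε] at this
      linarith
    calc D * √X ≤ ε / 2 * √X * √X := by gcongr
      _ = ε / 2 * X := by rw [mul_assoc, Real.mul_self_sqrt (Nat.cast_nonneg X)]
  linarith [card_filter_forall_prime_sq_dvd_le (by exact_mod_cast hP0.ne' : P ≠ 0) X]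

theorem tendsto_sum_div_sq_of_le_of_prime_dvd {f : ℕ → ℝ} (hf₀ : ∀ q, 0 ≤ f q)
    (hf : ∀ q, f q ≤ q)
    (hsmall : ∀ ε > 0, ∃ P : ℕ, ∀ q p : ℕ, p.Prime → P < p → p ∣ q → ¬ p ^ 2 ∣ q → f q ≤ ε * q) :
    Tendsto (fun X : ℕ => (∑ q ∈ Finset.Ioc 0 X, f q) / (X : ℝ) ^ 2) atTop (𝓝 0) := by
  classical
  refine tendsto_order.2 ⟨fun a ha => .of_forall fun X => ha.trans_le
    (div_nonneg (Finset.sum_nonneg fun q _ => hf₀ q) (by positivity)), fun a ha => ?_⟩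
  obtain ⟨P₁, hP₁⟩ := hsmall (a / 3) (by positivity)
  obtain ⟨P₂, hP₂⟩ := exists_eventually_card_filter_forall_prime_sq_dvd_le
    (by positivity : 0 < a / 3)
  filter_upwards [hP₂ (max P₁ P₂) (le_max_right _ _), eventually_gt_atTop 0] with X hcard hX
  set bad : ℕ → Prop := fun q => ∀ p : ℕ, p.Prime → max P₁ P₂ < p → p ∣ q → p ^ 2 ∣ q
  have hterm (q : ℕ) (hq : q ∈ Finset.Ioc 0 X) :
      f q ≤ a / 3 * X + if bad q then (X : ℝ) else 0 := by
    have hqX : (q : ℝ) ≤ X := by exact_mod_cast (Finset.mem_Ioc.1 hq).2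
    split_ifs with hbad
    · exact (hf q).trans (by linarith [show 0 ≤ a / 3 * X by positivity])
    · simp only [bad, not_forall] at hbad
      obtain ⟨p, hp, hPp, hpq, hpq2⟩ := hbad
      have : a / 3 * q ≤ a / 3 * X := by gcongr
      linarith [hP₁ q p hp ((le_max_left _ _).trans_lt hPp) hpq hpq2]
  have hsum : ∑ q ∈ Finset.Ioc 0 X, f q ≤ 2 * a / 3 * (X : ℝ) ^ 2 := by
    calc ∑ q ∈ Finset.Ioc 0 X, f q
        ≤ X * (a / 3 * X) + ((Finset.Ioc 0 X).filter bad).card * X := by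
          refine (Finset.sum_le_sum hterm).trans_eq ?_
          rw [Finset.sum_add_distrib, Finset.sum_const, Nat.card_Ioc, Nat.sub_zero, nsmul_eq_mul,
            ← Finset.sum_filter, Finset.sum_const, nsmul_eq_mul]
      _ ≤ X * (a / 3 * X) + a / 3 * X * X := by gcongr
      _ = 2 * a / 3 * (X : ℝ) ^ 2 := by ring
  rw [div_lt_iff₀ (by positivity)]
  linarith [show 0 < a * (X : ℝ) ^ 2 by positivity]

end Sieve

section Totient

open ArithmeticFunction in
theorem tsum_moebius_div_sq : ∑' d : ℕ, (moebius d : ℝ) / (d : ℝ) ^ 2 = 6 / Real.pi ^ 2 := by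
  have hprod := LSeries_zeta_mul_Lseries_moebius (s := 2) (by norm_num)
  have hseries : LSeries (fun n => ((moebius n : ℤ) : ℂ)) 2 =
      ((∑' d : ℕ, (moebius d : ℝ) / (d : ℝ) ^ 2 : ℝ) : ℂ) := by
    rw [Complex.ofReal_tsum, LSeries]
    refine tsum_congr fun d => ?_
    rcases eq_or_ne d 0 with rfl | hd
    · simp
    · rw [LSeries.term_of_ne_zero hd]
      push_cast
      norm_cast
  rw [LSeries_zeta_eq_riemannZeta (by norm_num), riemannZeta_two, hseries] at hprod
  have hreal : Real.pi ^ 2 / 6 * ∑' d : ℕ, (moebius d : ℝ) / (d : ℝ) ^ 2 = 1 := by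
    exact_mod_cast hprod
  rw [eq_div_iff (by positivity)]
  linear_combination 6 * hreal

open ArithmeticFunction in
theorem sum_Ioc_totient_eq_tsum (X : ℕ) :
    ∑ n ∈ Finset.Ioc 0 X, (n.totient : ℝ) =
      ∑' d : ℕ, (moebius d : ℝ) * ((X / d : ℕ) * ((X / d : ℕ) + 1) / 2) := by
  have hmoebius (n : ℕ) (hn : n ∈ Finset.Ioc 0 X) : (n.totient : ℝ) =
      ((moebius : ArithmeticFunction ℝ) *
        ((ArithmeticFunction.id : ArithmeticFunction ℕ) : ArithmeticFunction ℝ)) n := by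
    have hinv := (sum_eq_iff_sum_mul_moebius_eq (R := ℝ)
      (f := fun n => (n.totient : ℝ)) (g := fun n => (n : ℝ))).1
      (fun n _ => by exact_mod_cast Nat.sum_totient n) n (Finset.mem_Ioc.1 hn).1
    simp [ArithmeticFunction.mul_apply, ← hinv]
  have hgauss (k : ℕ) : ∑ n ∈ Finset.Ioc 0 k,
      ((ArithmeticFunction.id : ArithmeticFunction ℕ) : ArithmeticFunction ℝ) n =
        (k : ℝ) * (k + 1) / 2 := by
    induction k with
    | zero => simp
    | succ k ih =>
      rw [Finset.sum_Ioc_succ_top (Nat.zero_le k), ih, natCoe_apply, id_apply]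
      push_cast
      ring
  rw [Finset.sum_congr rfl hmoebius, sum_Ioc_mul_eq_sum_sum, tsum_eq_sum (s := Finset.Ioc 0 X)]
  · simp only [hgauss, intCoe_apply]
  · intro d hd
    rcases eq_or_ne d 0 with rfl | hd0
    · simp
    · have hlt : X < d := by
        simp only [Finset.mem_Ioc, not_and, not_le] at hd
        exact hd (Nat.pos_of_ne_zero hd0)
      simp [Nat.div_eq_of_lt hlt]

theorem tendsto_natCast_div_div (d : ℕ) :
    Tendsto (fun X : ℕ => ((X / d : ℕ) : ℝ) / X) atTop (𝓝 (1 / d)) := by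
  refine ((tendsto_nat_floor_mul_div_atTop (R := ℝ) (a := 1 / d) (by positivity)).comp
    tendsto_natCast_atTop_atTop).congr fun X => ?_
  rw [Function.comp_apply, one_div_mul_eq_div, Nat.floor_div_eq_div]

theorem natCast_div_mul_succ_div_two_le (X d : ℕ) :
    ((X / d : ℕ) * ((X / d : ℕ) + 1) / 2 : ℝ) ≤ (X / d) ^ 2 := by
  have hdiv : ((X / d : ℕ) : ℝ) ≤ X / d := Nat.cast_div_le
  have hself : ((X / d : ℕ) : ℝ) ≤ ((X / d : ℕ) : ℝ) ^ 2 := by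
    exact_mod_cast Nat.le_self_pow two_ne_zero _
  have hsq : ((X / d : ℕ) : ℝ) ^ 2 ≤ (X / d) ^ 2 := by gcongr
  linarith

open ArithmeticFunction in
theorem tendsto_sum_Ioc_totient_div_sq :
    Tendsto (fun X : ℕ => (∑ n ∈ Finset.Ioc 0 X, (n.totient : ℝ)) / (X : ℝ) ^ 2) atTop
      (𝓝 (3 / Real.pi ^ 2)) := by
  have hconst : 3 / Real.pi ^ 2 = ∑' d : ℕ, (moebius d : ℝ) / (d : ℝ) ^ 2 / 2 := by
    rw [tsum_div_const, tsum_moebius_div_sq]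
    ring
  simp_rw [hconst, sum_Ioc_totient_eq_tsum, ← tsum_div_const]
  refine tendsto_tsum_of_dominated_convergence (bound := fun d : ℕ => 1 / (d : ℝ) ^ 2)
    (Real.summable_one_div_nat_pow.2 one_lt_two) (fun d => ?_) (.of_forall fun X d => ?_)
  · have hlim := (((tendsto_natCast_div_div d).mul ((tendsto_natCast_div_div d).add
      tendsto_one_div_atTop_nhds_zero_nat)).div_const 2).const_mul (moebius d : ℝ)
    rw [show (moebius d : ℝ) * (1 / d * (1 / d + 0) / 2) = (moebius d : ℝ) / (d : ℝ) ^ 2 / 2 by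
      ring] at hlim
    exact hlim.congr fun X => by ring
  · rcases eq_or_ne X 0 with rfl | hX
    · simp
    have hmoebius : ‖(moebius d : ℝ)‖ ≤ 1 := by
      rw [Real.norm_eq_abs]
      exact_mod_cast abs_moebius_le_one
    rw [norm_div, norm_mul, Real.norm_of_nonneg (by positivity : (0 : ℝ) ≤ (X : ℝ) ^ 2),
      Real.norm_of_nonneg (by positivity : (0 : ℝ) ≤ (X / d : ℕ) * ((X / d : ℕ) + 1) / 2),
      div_le_iff₀ (by positivity)]
    calc _ ≤ 1 * ((X / d : ℝ) ^ 2) := by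
          gcongr
          exact natCast_div_mul_succ_div_two_le X d
      _ = _ := by ring

end Totient

section Equidistribution

open MeasureTheory

theorem tendsto_probabilityMeasure_of_span_topologicalClosure_eq_top {X ι : Type*}
    [TopologicalSpace X] [CompactSpace X] [MeasurableSpace X] [OpensMeasurableSpace X]
    {l : Filter ι} {μs : ι → ProbabilityMeasure X} {ν : ProbabilityMeasure X} {S : Set C(X, ℂ)}
    (hS : (Submodule.span ℂ S).topologicalClosure = ⊤)
    (h : ∀ f ∈ S, Tendsto (fun i => ∫ x, f x ∂(μs i : Measure X)) l
      (𝓝 (∫ x, f x ∂(ν : Measure X)))) :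
    Tendsto μs l (𝓝 ν) := by
  have hint (μ : ProbabilityMeasure X) (f : C(X, ℂ)) : Integrable f (μ : Measure X) :=
    (BoundedContinuousFunction.mkOfCompact f).integrable _
  have hspan (f : C(X, ℂ)) (hf : f ∈ Submodule.span ℂ S) :
      Tendsto (fun i => ∫ x, f x ∂(μs i : Measure X)) l (𝓝 (∫ x, f x ∂(ν : Measure X))) := by
    induction hf using Submodule.span_induction with
    | mem f hf => exact h f hf
    | zero => simpa using tendsto_const_nhds
    | add f g _ _ hf hg =>
      simpa only [ContinuousMap.add_apply, integral_add (hint _ f) (hint _ g)] using hf.add hg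
    | smul c f _ hf =>
      simpa only [ContinuousMap.smul_apply, integral_smul] using hf.const_smul c
  have hdist (μ : ProbabilityMeasure X) (f g : C(X, ℂ)) :
      dist (∫ x, f x ∂(μ : Measure X)) (∫ x, g x ∂(μ : Measure X)) ≤ dist f g := by
    rw [dist_eq_norm, ← integral_sub (hint μ f) (hint μ g)]
    refine (norm_integral_le_of_norm_le_const (C := dist f g) (.of_forall fun x => ?_)).trans
      (by simp)
    rw [← dist_eq_norm]
    exact ContinuousMap.dist_apply_le_dist x
  rw [ProbabilityMeasure.tendsto_iff_forall_integral_rclike_tendsto ℂ]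
  intro f
  rw [Metric.tendsto_nhds]
  intro ε hε
  have hf : f.toContinuousMap ∈ closure (Submodule.span ℂ S : Set C(X, ℂ)) := by
    rw [← Submodule.topologicalClosure_coe, hS]
    trivial
  obtain ⟨g, hg, hfg⟩ := Metric.mem_closure_iff.1 hf (ε / 3) (by positivity)
  filter_upwards [Metric.tendsto_nhds.1 (hspan g hg) (ε / 3) (by positivity)] with i hi
  calc _ ≤ _ := dist_triangle4 _ (∫ x, g x ∂(μs i : Measure X)) (∫ x, g x ∂(ν : Measure X)) _
    _ < ε := by
      have hμ := hdist (μs i) f.toContinuousMap g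
      have hν := hdist ν g f.toContinuousMap
      rw [dist_comm g] at hν
      exact (add_lt_add_of_lt_of_le (add_lt_add_of_le_of_lt hμ hi) hν).trans_le (by linarith)

theorem tendsto_probabilityMeasure_of_tendsto_map {X Y ι : Type*} [TopologicalSpace X]
    [MeasurableSpace X] [OpensMeasurableSpace X] [HasOuterApproxClosed X]
    [TopologicalSpace Y] [MeasurableSpace Y] [BorelSpace Y] [HasOuterApproxClosed Y]
    {l : Filter ι} [l.IsCountablyGenerated] {π : X → Y} (hπ : Continuous π) (hopen : IsOpenMap π)
    {I D : Set X} (hI : IsOpen I) (hID : I ⊆ D) (hinj : Set.InjOn π D)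
    {μs : ι → ProbabilityMeasure X} {ν : ProbabilityMeasure X} (hν : (ν : Measure X) Iᶜ = 0)
    (hμs : ∀ i, (μs i : Measure X) Dᶜ = 0)
    (h : Tendsto (fun i => (μs i).map hπ.measurable.aemeasurable) l
      (𝓝 (ν.map hπ.measurable.aemeasurable))) :
    Tendsto μs l (𝓝 ν) := by
  refine tendsto_of_forall_isOpen_le_liminf' fun U hU => ?_
  have hV : IsOpen (π '' (U ∩ I)) := hopen _ (hU.inter hI)
  have hmap (μ : ProbabilityMeasure X) :
      (μ.map hπ.measurable.aemeasurable : Measure Y) (π '' (U ∩ I)) =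
        (μ : Measure X) (π ⁻¹' (π '' (U ∩ I))) := by
    rw [ProbabilityMeasure.toMeasure_map, Measure.map_apply hπ.measurable hV.measurableSet]
  calc (ν : Measure X) U = (ν : Measure X) (U ∩ I) :=
        (measure_inter_conull hν).symm
    _ ≤ (ν.map hπ.measurable.aemeasurable : Measure Y) (π '' (U ∩ I)) := by
        rw [hmap]
        exact measure_mono (Set.subset_preimage_image _ _)
    _ ≤ liminf (fun i => ((μs i).map hπ.measurable.aemeasurable : Measure Y) (π '' (U ∩ I))) l :=
        ProbabilityMeasure.le_liminf_measure_open_of_tendsto h hV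
    _ ≤ liminf (fun i => (μs i : Measure X) U) l := by
        refine liminf_le_liminf (.of_forall fun i => ?_)
        rw [hmap, ← measure_inter_conull (hμs i)]
        refine measure_mono ?_
        rintro x ⟨⟨y, ⟨hyU, hyI⟩, hyx⟩, hxD⟩
        rwa [← hinj (hID hyI) hxD hyx]

variable {d : Type*}

/-- The projection from Euclidean space to the torus. -/
def torusMk (x : d → ℝ) : UnitAddTorus d := fun i => (x i : UnitAddCircle)

theorem continuous_torusMk : Continuous (torusMk (d := d)) :=
  continuous_pi fun i => (AddCircle.continuous_mk' 1).comp (continuous_apply i)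

theorem isOpenMap_torusMk [Finite d] : IsOpenMap (torusMk (d := d)) :=
  IsOpenMap.piMap (fun _ => QuotientAddGroup.isOpenMap_coe) (by simp)

/-- The half-open unit cube `(0, 1]ᵈ`, a fundamental domain for the torus. -/
def unitCube (d : Type*) : Set (d → ℝ) := Set.univ.pi fun _ => Set.Ioc 0 1

theorem injOn_torusMk_unitCube : Set.InjOn torusMk (unitCube d) := by
  intro x hx y hy h
  funext i
  have hxi := hx i trivial
  have hyi := hy i trivial
  rw [← zero_add (1 : ℝ)] at hxi hyi
  exact (AddCircle.coe_eq_coe_iff_of_mem_Ioc hxi hyi).1 (congrFun h i)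

theorem measurableSet_unitCube [Countable d] : MeasurableSet (unitCube d) :=
  MeasurableSet.univ_pi fun _ => measurableSet_Ioc

variable [Fintype d]

theorem volume_unitCube : volume (unitCube d) = 1 := by
  simp [unitCube, Real.volume_pi_Ioc]

/-- The uniform probability measure on the unit cube. -/
noncomputable def cubeProbability (d : Type*) [Fintype d] : ProbabilityMeasure (d → ℝ) :=
  ⟨volume.restrict (unitCube d), ⟨by simp [volume_unitCube]⟩⟩

theorem integral_fourier_Ioc {n : ℤ} (hn : n ≠ 0) :
    ∫ x in Set.Ioc (0 : ℝ) 1, (fourier n (x : UnitAddCircle) : ℂ) = 0 := by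
  have hexp (x : ℝ) : (fourier n (x : UnitAddCircle) : ℂ) =
      Complex.exp (2 * Real.pi * Complex.I * n * x) := by
    rw [fourier_coe_apply, Complex.ofReal_one, div_one]
  have hfreq : (2 * Real.pi * Complex.I * n : ℂ) ≠ 0 := by simp [Real.pi_ne_zero, hn]
  simp_rw [hexp]
  rw [← intervalIntegral.integral_of_le zero_le_one, integral_exp_mul_complex hfreq,
    Complex.ofReal_one, Complex.ofReal_zero, mul_one, mul_zero, Complex.exp_zero,
    show (2 * Real.pi * Complex.I * n : ℂ) = n * (2 * Real.pi * Complex.I) by ring,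
    Complex.exp_int_mul_two_pi_mul_I, sub_self, zero_div]

theorem integral_mFourier_unitCube {n : d → ℤ} (hn : n ≠ 0) :
    ∫ x in unitCube d, UnitAddTorus.mFourier n (torusMk x) = 0 := by
  obtain ⟨i, hi⟩ := Function.ne_iff.1 hn
  rw [unitCube, volume_pi, Measure.restrict_pi_pi]
  exact (integral_fintype_prod_eq_prod (fun i (x : ℝ) => fourier (n i) (x : UnitAddCircle))).trans
      (Finset.prod_eq_zero (Finset.mem_univ i) (integral_fourier_Ioc hi))

theorem tendsto_cubeProbability {ι : Type*} {l : Filter ι} [l.IsCountablyGenerated]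
    {μs : ι → ProbabilityMeasure (d → ℝ)} (hμs : ∀ i, (μs i : Measure (d → ℝ)) (unitCube d)ᶜ = 0)
    (h : ∀ n : d → ℤ, n ≠ 0 →
      Tendsto (fun i => ∫ x, UnitAddTorus.mFourier n (torusMk x) ∂(μs i : Measure (d → ℝ))) l
        (𝓝 0)) :
    Tendsto μs l (𝓝 (cubeProbability d)) := by
  have hopen : (cubeProbability d : Measure (d → ℝ))
      (Set.univ.pi fun _ => Set.Ioo (0 : ℝ) 1)ᶜ = 0 := by
    rw [cubeProbability, ProbabilityMeasure.coe_mk, unitCube, volume_pi,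
      Measure.restrict_congr_set Measure.pi_Ioo_ae_eq_pi_Ioc.symm,
      Measure.restrict_apply (MeasurableSet.univ_pi fun _ => measurableSet_Ioo).compl,
      Set.compl_inter_self, measure_empty]
  refine tendsto_probabilityMeasure_of_tendsto_map continuous_torusMk isOpenMap_torusMk
    (isOpen_set_pi Set.finite_univ fun _ _ => isOpen_Ioo)
    (Set.pi_mono fun _ _ => Set.Ioo_subset_Ioc_self) injOn_torusMk_unitCube hopen hμs ?_
  refine tendsto_probabilityMeasure_of_span_topologicalClosure_eq_top
    UnitAddTorus.span_mFourier_closure_eq_top ?_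
  rintro _ ⟨n, rfl⟩
  have hmap (μ : ProbabilityMeasure (d → ℝ)) :
      ∫ x, UnitAddTorus.mFourier n x ∂(μ.map
        continuous_torusMk.measurable.aemeasurable : Measure (UnitAddTorus d)) =
        ∫ x, UnitAddTorus.mFourier n (torusMk x) ∂(μ : Measure (d → ℝ)) :=
    integral_map continuous_torusMk.measurable.aemeasurable
      (UnitAddTorus.mFourier n).continuous.aestronglyMeasurable
  simp only [hmap]
  rcases eq_or_ne n 0 with rfl | hn
  · simpa [UnitAddTorus.mFourier_zero] using tendsto_const_nhds
  · rw [cubeProbability, ProbabilityMeasure.coe_mk, integral_mFourier_unitCube hn]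
    exact h n hn

/-- The uniform distribution on the points `f i`, `i ∈ s`, counted with multiplicity. -/
noncomputable def empiricalProbability {ι X : Type*} [MeasurableSpace X] (s : Finset ι)
    (hs : s.Nonempty) (f : ι → X) : ProbabilityMeasure X :=
  ⟨(s.card : ENNReal)⁻¹ • ∑ i ∈ s, Measure.dirac (f i), ⟨by
    simpa using ENNReal.inv_mul_cancel (by simpa using hs.ne_empty) (by simp)⟩⟩

theorem empiricalProbability_apply {ι X : Type*} [MeasurableSpace X] {s : Finset ι}
    (hs : s.Nonempty) (f : ι → X) {U : Set X} [DecidablePred fun i => f i ∈ U]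
    (hU : MeasurableSet U) :
    (empiricalProbability s hs f : Measure X) U =
      (s.card : ENNReal)⁻¹ * (s.filter fun i => f i ∈ U).card := by
  simp [empiricalProbability, Measure.dirac_apply' _ hU, Set.indicator_apply]

theorem integral_empiricalProbability {ι X : Type*} [MeasurableSpace X]
    [MeasurableSingletonClass X] {s : Finset ι} (hs : s.Nonempty) (f : ι → X) (g : X → ℂ) :
    ∫ x, g x ∂(empiricalProbability s hs f : Measure X) = (∑ i ∈ s, g (f i)) / s.card := by
  rw [empiricalProbability, ProbabilityMeasure.coe_mk, integral_smul_measure,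
    integral_finsetSum_measure fun i _ => integrable_dirac (by finiteness)]
  simp [div_eq_inv_mul]

open Classical in
theorem tendsto_card_filter_mem_div_card {ι κ : Type*} {l : Filter κ} [l.IsCountablyGenerated]
    {s : κ → Finset ι} (hs : ∀ k, (s k).Nonempty) {f : ι → d → ℝ}
    (hf : ∀ k, ∀ i ∈ s k, f i ∈ unitCube d)
    (h : ∀ n : d → ℤ, n ≠ 0 → Tendsto (fun k =>
      (∑ i ∈ s k, UnitAddTorus.mFourier n (torusMk (f i))) / (s k).card) l (𝓝 0))
    {U : Set (d → ℝ)} (hU : MeasurableSet U) (hU₀ : volume (frontier U) = 0) :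
    Tendsto (fun k => (((s k).filter fun i => f i ∈ U).card : ℝ) / (s k).card) l
      (𝓝 (volume.real (U ∩ unitCube d))) := by
  have hweak : Tendsto (fun k => empiricalProbability (s k) (hs k) f) l
      (𝓝 (cubeProbability d)) := by
    refine tendsto_cubeProbability (fun k => ?_) fun n hn => ?_
    · rw [empiricalProbability_apply _ _ measurableSet_unitCube.compl,
        Finset.filter_false_of_mem fun i hi hmem => hmem (hf k i hi)]
      simp
    · simpa only [integral_empiricalProbability] using h n hn
  have hmeas := (ENNReal.tendsto_toReal (measure_ne_top _ U)).comp
    (ProbabilityMeasure.tendsto_measure_of_null_frontier_of_tendsto' hweak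
      (Measure.restrict_le_self.absolutelyContinuous hU₀))
  rw [Measure.real, ← Measure.restrict_apply hU]
  refine hmeas.congr fun k => ?_
  rw [Function.comp_apply, empiricalProbability_apply _ _ hU]
  simp [div_eq_inv_mul]

end Equidistribution

section InversePairs

open MeasureTheory

/-- The representative in `{1, …, b}` of a residue class modulo `b`. -/
def posRep {b : ℕ} (x : ZMod b) : ℕ := (x - 1).val + 1

theorem posRep_mem_Ioc {b : ℕ} [NeZero b] (x : ZMod b) : posRep x ∈ Finset.Ioc 0 b :=
  Finset.mem_Ioc.2 ⟨Nat.succ_pos _, ZMod.val_lt _⟩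

theorem natCast_posRep {b : ℕ} [NeZero b] (x : ZMod b) : ((posRep x : ℕ) : ZMod b) = x := by
  simp [posRep]

theorem posRep_natCast {b d : ℕ} (hd : d ∈ Finset.Ioc 0 b) : posRep (d : ZMod b) = d := by
  obtain ⟨k, rfl⟩ := Nat.exists_eq_add_of_lt (Finset.mem_Ioc.1 hd).1
  simp only [zero_add] at hd ⊢
  rw [posRep, Nat.cast_succ, add_sub_cancel_right, ZMod.val_cast_of_lt (Finset.mem_Ioc.1 hd).2]

theorem posRep_natCast_le {b k : ℕ} (hk : 0 < k) : posRep (k : ZMod b) ≤ k := by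
  obtain ⟨k, rfl⟩ := Nat.exists_eq_add_of_lt hk
  rw [posRep, zero_add, Nat.cast_succ, add_sub_cancel_right, ZMod.val_natCast]
  exact Nat.succ_le_succ (Nat.mod_le _ _)

theorem posRep_inv_natCast_le {b d k : ℕ} (hk : 0 < k) (hkd : (k : ZMod b) * d = 1) :
    posRep (d : ZMod b)⁻¹ ≤ k := by
  rw [ZMod.inv_eq_of_mul_eq_one b _ _ (by rwa [mul_comm] : (d : ZMod b) * k = 1)]
  exact posRep_natCast_le hk

/-- The pairs `(b, d)` with `1 ≤ d ≤ b ≤ X` and `d` coprime to `b`. -/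
def coprimePairs (X : ℕ) : Finset ((_ : ℕ) × ℕ) :=
  (Finset.Ioc 0 X).sigma fun b => (Finset.Ioc 0 b).filter b.Coprime

/-- The point `(d / b, d̄ / b)` of the unit square, where `d d̄ ≡ 1` modulo `b`. -/
noncomputable def inversePoint (p : (_ : ℕ) × ℕ) : Fin 2 → ℝ :=
  ![(p.2 : ℝ) / p.1, (posRep (p.2 : ZMod p.1)⁻¹ : ℝ) / p.1]

theorem mem_coprimePairs {X : ℕ} {p : (_ : ℕ) × ℕ} :
    p ∈ coprimePairs X ↔ p.1 ≤ X ∧ 0 < p.2 ∧ p.2 ≤ p.1 ∧ p.1.Coprime p.2 := by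
  simp only [coprimePairs, Finset.mem_sigma, Finset.mem_filter, Finset.mem_Ioc]
  omega

theorem card_coprimePairs (X : ℕ) :
    (coprimePairs X).card = ∑ b ∈ Finset.Ioc 0 X, b.totient := by
  rw [coprimePairs, Finset.card_sigma]
  refine Finset.sum_congr rfl fun b _ => ?_
  rw [← Nat.filter_coprime_Ico_eq_totient b 1]
  congr 2
  ext d
  simp only [Finset.mem_Ioc, Finset.mem_Ico]
  omega

theorem inversePoint_mem_unitCube {X : ℕ} {p : (_ : ℕ) × ℕ} (hp : p ∈ coprimePairs X) :
    inversePoint p ∈ unitCube (Fin 2) := by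
  obtain ⟨-, hd₀, hdb, -⟩ := mem_coprimePairs.1 hp
  have : NeZero p.1 := ⟨by omega⟩
  have hmem (k : ℕ) (hk : k ∈ Finset.Ioc 0 p.1) : (k : ℝ) / p.1 ∈ Set.Ioc (0 : ℝ) 1 := by
    obtain ⟨hk₀, hkb⟩ := Finset.mem_Ioc.1 hk
    have hb : (0 : ℝ) < p.1 := by exact_mod_cast hk₀.trans_le hkb
    exact ⟨div_pos (by exact_mod_cast hk₀) hb, (div_le_one hb).2 (by exact_mod_cast hkb)⟩
  rw [unitCube, Set.mem_univ_pi, Fin.forall_fin_two]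
  exact ⟨hmem _ (Finset.mem_Ioc.2 ⟨hd₀, hdb⟩), hmem _ (posRep_mem_Ioc _)⟩

theorem mFourier_torusMk_natCast_div (n : Fin 2 → ℤ) (b k l : ℕ) [NeZero b] :
    UnitAddTorus.mFourier n (torusMk ![(k : ℝ) / b, (l : ℝ) / b]) =
      zmodPairChar b (n 0) (n 1) (k, l) := by
  have hcast : zmodPairChar b (n 0) (n 1) (k, l) =
      ZMod.stdAddChar (N := b) ((n 0 * k + n 1 * l : ℤ) : ZMod b) := by
    simp [zmodPairChar]
  rw [hcast, ZMod.stdAddChar_coe]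
  simp only [UnitAddTorus.mFourier, ContinuousMap.coe_mk, Fin.prod_univ_two, torusMk,
    fourier_coe_apply]
  rw [← Complex.exp_add]
  congr 1
  simp
  field_simp

theorem sum_mFourier_inversePoint (n : Fin 2 → ℤ) (b : ℕ) [NeZero b] :
    ∑ d ∈ (Finset.Ioc 0 b).filter b.Coprime,
      UnitAddTorus.mFourier n (torusMk (inversePoint ⟨b, d⟩)) =
      kloostermanSum (zmodPairChar b (n 0) (n 1)) := by
  symm
  refine Finset.sum_bij (fun (u : (ZMod b)ˣ) _ => posRep (u : ZMod b)) (fun u _ => ?_)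
    (fun u _ v _ h => ?_) (fun d hd => ?_) (fun u _ => ?_)
  · refine Finset.mem_filter.2 ⟨posRep_mem_Ioc _, Nat.Coprime.symm ?_⟩
    rw [← ZMod.isUnit_iff_coprime, natCast_posRep]
    exact u.isUnit
  · rw [← Units.val_inj, ← natCast_posRep (u : ZMod b), h, natCast_posRep]
  · obtain ⟨hdb, hcop⟩ := Finset.mem_filter.1 hd
    exact ⟨ZMod.unitOfCoprime d hcop.symm, Finset.mem_univ _, by
      rw [ZMod.coe_unitOfCoprime, posRep_natCast hdb]⟩
  · rw [inversePoint, mFourier_torusMk_natCast_div, natCast_posRep, natCast_posRep,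
      ZMod.inv_coe_unit]

theorem tendsto_sum_norm_sum_mFourier_inversePoint {n : Fin 2 → ℤ} (hn : n ≠ 0) :
    Tendsto (fun X : ℕ => (∑ b ∈ Finset.Ioc 0 X, ‖∑ d ∈ (Finset.Ioc 0 b).filter b.Coprime,
      UnitAddTorus.mFourier n (torusMk (inversePoint ⟨b, d⟩))‖) / (X : ℝ) ^ 2) atTop (𝓝 0) := by
  refine tendsto_sum_div_sq_of_le_of_prime_dvd (fun b => norm_nonneg _) (fun b => ?_)
    fun ε hε => ?_
  · rcases eq_or_ne b 0 with rfl | hb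
    · simp
    have : NeZero b := ⟨hb⟩
    rw [sum_mFourier_inversePoint]
    refine (norm_kloostermanSum_le_card_units _).trans ?_
    rw [ZMod.card_units_eq_totient]
    exact_mod_cast Nat.totient_le b
  · obtain ⟨P, hP⟩ := exists_norm_kloostermanSum_zmodPairChar_le_mul (m := n 0) (n := n 1)
      (by contrapose! hn; exact funext (Fin.forall_fin_two.2 hn)) hε
    refine ⟨P, fun b p hp hPp hpb hpb₂ => ?_⟩
    rcases eq_or_ne b 0 with rfl | hb
    · simp
    have : NeZero b := ⟨hb⟩
    rw [sum_mFourier_inversePoint]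
    exact hP b p hp hPp hpb hpb₂

theorem tendsto_card_coprimePairs_div_sq :
    Tendsto (fun X : ℕ => ((coprimePairs X).card : ℝ) / (X : ℝ) ^ 2) atTop
      (𝓝 (3 / Real.pi ^ 2)) := by
  simpa only [card_coprimePairs, Nat.cast_sum] using tendsto_sum_Ioc_totient_div_sq

theorem nonempty_coprimePairs (X : ℕ) : (coprimePairs (X + 1)).Nonempty :=
  ⟨⟨1, 1⟩, mem_coprimePairs.2 (by simp)⟩

theorem tendsto_sum_mFourier_inversePoint_div_card {n : Fin 2 → ℤ} (hn : n ≠ 0) :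
    Tendsto (fun X : ℕ => (∑ p ∈ coprimePairs X,
      UnitAddTorus.mFourier n (torusMk (inversePoint p))) / ((coprimePairs X).card : ℂ))
      atTop (𝓝 0) := by
  have hlim := (tendsto_sum_norm_sum_mFourier_inversePoint hn).div
    tendsto_card_coprimePairs_div_sq (by positivity)
  rw [zero_div] at hlim
  refine squeeze_zero_norm' ?_ hlim
  filter_upwards [eventually_gt_atTop 0] with X hX
  have hX₂ : (X : ℝ) ^ 2 ≠ 0 := by positivity
  rw [Pi.div_apply, div_div_div_cancel_right₀ hX₂, norm_div, Complex.norm_natCast, coprimePairs,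
    Finset.sum_sigma]
  gcongr
  exact norm_sum_le _ _

open Classical in
theorem tendsto_card_filter_inversePoint_mem_div_sq {U : Set (Fin 2 → ℝ)} (hU : MeasurableSet U)
    (hU₀ : volume (frontier U) = 0) :
    Tendsto (fun X : ℕ => (((coprimePairs X).filter fun p => inversePoint p ∈ U).card : ℝ) /
      (X : ℝ) ^ 2) atTop (𝓝 (3 / Real.pi ^ 2 * volume.real (U ∩ unitCube (Fin 2)))) := by
  rw [← tendsto_add_atTop_iff_nat 1]
  have hprop := tendsto_card_filter_mem_div_card nonempty_coprimePairs
    (fun _ _ => inversePoint_mem_unitCube)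
    (fun n hn => (tendsto_sum_mFourier_inversePoint_div_card hn).comp (tendsto_add_atTop_nat 1))
    hU hU₀
  refine ((tendsto_card_coprimePairs_div_sq.comp (tendsto_add_atTop_nat 1)).mul hprop).congr
    fun X => ?_
  have hcard : ((coprimePairs (X + 1)).card : ℝ) ≠ 0 := by
    exact_mod_cast (nonempty_coprimePairs X).card_ne_zero
  rw [Function.comp_apply, mul_comm, div_mul_div_cancel₀ hcard]

open Classical in
theorem tendsto_card_filter_floor_inversePoint_mem_div_sq {U : Set (Fin 2 → ℝ)}
    (hU : MeasurableSet U) (hU₀ : volume (frontier U) = 0) {c : ℝ} (hc : 0 < c) :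
    Tendsto (fun Q : ℕ => (((coprimePairs ⌊(Q : ℝ) / c⌋₊).filter
      fun p => inversePoint p ∈ U).card : ℝ) / (Q : ℝ) ^ 2) atTop
      (𝓝 (3 / Real.pi ^ 2 * (volume.real (U ∩ unitCube (Fin 2)) / c ^ 2))) := by
  have hfloor : Tendsto (fun Q : ℕ => ⌊(Q : ℝ) / c⌋₊) atTop atTop :=
    tendsto_nat_floor_atTop.comp (tendsto_natCast_atTop_atTop.atTop_div_const hc)
  have hratio : Tendsto (fun Q : ℕ => (⌊(Q : ℝ) / c⌋₊ : ℝ) / Q) atTop (𝓝 (1 / c)) := by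
    simpa only [Function.comp_def, one_div_mul_eq_div] using
      (tendsto_nat_floor_mul_div_atTop (one_div_nonneg.2 hc.le)).comp tendsto_natCast_atTop_atTop
  have hlim := ((tendsto_card_filter_inversePoint_mem_div_sq hU hU₀).comp hfloor).mul
    (hratio.pow 2)
  rw [mul_assoc, one_div, inv_pow, ← div_eq_mul_inv] at hlim
  refine hlim.congr' ?_
  filter_upwards [hfloor.eventually_gt_atTop 0] with Q hQ
  have hX : (⌊(Q : ℝ) / c⌋₊ : ℝ) ≠ 0 := by exact_mod_cast hQ.ne'
  rw [Function.comp_apply, div_pow, div_mul_div_cancel₀ (pow_ne_zero 2 hX)]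

end InversePairs

section Slicing

open MeasureTheory

/-- The slice `x₀ ≤ β`, `cʲ ≤ 1 + x₀ + x₁ < cʲ⁺¹` of the plane, on which the bound
`b (1 + x₀ + x₁) ≤ Q` determines `b` up to a factor `c`. -/
def geometricSlice (β c : ℝ) (j : ℕ) : Set (Fin 2 → ℝ) :=
  {x | x 0 ≤ β ∧ 1 + x 0 + x 1 ∈ Set.Ico (c ^ j) (c ^ (j + 1))}

variable {β c : ℝ}

theorem convex_geometricSlice (j : ℕ) : Convex ℝ (geometricSlice β c j) := by
  rintro x ⟨hxβ, hx⟩ y ⟨hyβ, hy⟩ s t hs ht hst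
  refine ⟨convex_Iic β hxβ hyβ hs ht hst, ?_⟩
  convert convex_Ico _ _ hx hy hs ht hst using 1
  simp only [Pi.add_apply, Pi.smul_apply, smul_eq_mul]
  linear_combination -hst

theorem measurableSet_geometricSlice (j : ℕ) : MeasurableSet (geometricSlice β c j) :=
  (measurableSet_Iic.preimage (measurable_pi_apply 0)).inter
    (measurableSet_Ico.preimage (by fun_prop : Measurable fun x : Fin 2 → ℝ => 1 + x 0 + x 1))

theorem volume_frontier_geometricSlice (j : ℕ) : volume (frontier (geometricSlice β c j)) = 0 :=
  (convex_geometricSlice j).addHaar_frontier _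

theorem pairwise_disjoint_geometricSlice (hc : 1 ≤ c) :
    Pairwise (Function.onFun Disjoint (geometricSlice β c)) := fun _ _ hij =>
  Set.disjoint_left.2 fun _ hx hy =>
    Set.disjoint_left.1 ((pow_right_mono₀ hc).pairwise_disjoint_on_Ico_succ hij) hx.2 hy.2

theorem exists_mem_geometricSlice (hc : 1 < c) {J : ℕ} (hJ : 3 < c ^ J) {x : Fin 2 → ℝ}
    (hx : x ∈ unitCube (Fin 2)) (hxβ : x 0 ≤ β) :
    ∃ j ∈ Finset.range J, x ∈ geometricSlice β c j := by
  have hx₀ := hx 0 trivial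
  have hx₁ := hx 1 trivial
  simp only [Set.mem_Ioc] at hx₀ hx₁
  obtain ⟨j, hj, hj'⟩ := exists_nat_pow_near (x := 1 + x 0 + x 1) (by linarith) hc
  refine ⟨j, Finset.mem_range.2 ?_, hxβ, hj, hj'⟩
  exact (pow_lt_pow_iff_right₀ hc).1 (by linarith)

/-- The pairs `(b, d)` with `1 ≤ d ≤ b`, `d` coprime to `b`, `b + d + d̄ ≤ Q` and `d / b ≤ β`,
where `d̄` is the inverse of `d` modulo `b` in `{1, …, b}`. -/
noncomputable def hyperbolicPairs (β : ℝ) (Q : ℕ) : Finset ((_ : ℕ) × ℕ) :=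
  (coprimePairs Q).filter fun p =>
    p.1 + p.2 + posRep (p.2 : ZMod p.1)⁻¹ ≤ Q ∧ (p.2 : ℝ) / p.1 ≤ β

theorem mul_one_add_inversePoint {p : (_ : ℕ) × ℕ} (hp : p.1 ≠ 0) :
    (p.1 : ℝ) * (1 + inversePoint p 0 + inversePoint p 1) =
      ((p.1 + p.2 + posRep (p.2 : ZMod p.1)⁻¹ : ℕ) : ℝ) := by
  simp only [inversePoint, Matrix.cons_val_zero, Matrix.cons_val_one]
  push_cast
  field_simp

theorem mem_hyperbolicPairs {Q : ℕ} {p : (_ : ℕ) × ℕ} :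
    p ∈ hyperbolicPairs β Q ↔ p ∈ coprimePairs Q ∧ inversePoint p 0 ≤ β ∧
      (p.1 : ℝ) * (1 + inversePoint p 0 + inversePoint p 1) ≤ Q := by
  rw [hyperbolicPairs, Finset.mem_filter]
  refine and_congr_right fun hp => ?_
  have hb : p.1 ≠ 0 := by
    have := mem_coprimePairs.1 hp
    omega
  rw [mul_one_add_inversePoint hb, Nat.cast_le, and_comm]
  rfl

open Classical in
theorem card_hyperbolicPairs_le (Q : ℕ) (hc : 1 < c) {J : ℕ} (hJ : 3 < c ^ J) :
    (hyperbolicPairs β Q).card ≤ ∑ j ∈ Finset.range J,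
      ((coprimePairs ⌊(Q : ℝ) / c ^ j⌋₊).filter
        fun p => inversePoint p ∈ geometricSlice β c j).card := by
  refine (Finset.card_le_card fun p hp => ?_).trans Finset.card_biUnion_le
  obtain ⟨hp, hpβ, hpQ⟩ := mem_hyperbolicPairs.1 hp
  obtain ⟨j, hj, hpj⟩ := exists_mem_geometricSlice hc hJ (inversePoint_mem_unitCube hp) hpβ
  simp only [Finset.mem_biUnion, Finset.mem_filter]
  refine ⟨j, hj, mem_coprimePairs.2 ⟨Nat.le_floor ?_, (mem_coprimePairs.1 hp).2⟩, hpj⟩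
  rw [le_div_iff₀ (by positivity)]
  exact (mul_le_mul_of_nonneg_left hpj.2.1 (Nat.cast_nonneg _)).trans hpQ

open Classical in
theorem le_card_hyperbolicPairs (Q : ℕ) (hc : 1 ≤ c) (J : ℕ) :
    ∑ j ∈ Finset.range J, ((coprimePairs ⌊(Q : ℝ) / c ^ (j + 1)⌋₊).filter
      fun p => inversePoint p ∈ geometricSlice β c j).card ≤ (hyperbolicPairs β Q).card := by
  rw [← Finset.card_biUnion fun i _ j _ hij => ?_]
  · refine Finset.card_le_card fun p hp => ?_
    simp only [Finset.mem_biUnion, Finset.mem_filter] at hp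
    obtain ⟨j, -, hp, hpj⟩ := hp
    obtain ⟨hpb, hpd⟩ := mem_coprimePairs.1 hp
    have hcj : 1 ≤ c ^ (j + 1) := one_le_pow₀ hc
    have hpQ : (p.1 : ℝ) * c ^ (j + 1) ≤ Q :=
      (le_div_iff₀ (by positivity)).1 ((Nat.cast_le.2 hpb).trans (Nat.floor_le (by positivity)))
    have hbQ : (p.1 : ℝ) ≤ Q := (le_mul_of_one_le_right (Nat.cast_nonneg _) hcj).trans hpQ
    exact mem_hyperbolicPairs.2 ⟨mem_coprimePairs.2 ⟨by exact_mod_cast hbQ, hpd⟩, hpj.1,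
      (mul_le_mul_of_nonneg_left hpj.2.2.le (Nat.cast_nonneg _)).trans hpQ⟩
  · refine Finset.disjoint_left.2 fun p hpi hpj => ?_
    exact Set.disjoint_left.1 (pairwise_disjoint_geometricSlice hc hij)
      (Finset.mem_filter.1 hpi).2 (Finset.mem_filter.1 hpj).2

theorem integrableOn_inv_sq_unitCube :
    IntegrableOn (fun x : Fin 2 → ℝ => ((1 + x 0 + x 1) ^ 2)⁻¹) (unitCube (Fin 2)) := by
  refine IntegrableOn.of_bound (by simp [volume_unitCube])
    (Measurable.aestronglyMeasurable (by fun_prop)) 1 ?_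
  filter_upwards [ae_restrict_mem measurableSet_unitCube] with x hx
  have hx₀ := (hx 0 trivial).1
  have hx₁ := (hx 1 trivial).1
  rw [Real.norm_of_nonneg (by positivity)]
  exact inv_le_one_of_one_le₀ (one_le_pow₀ (by linarith))

/-- The integral of `(1 + x + y)⁻²` over the part `x ≤ β` of the unit square. -/
noncomputable def sliceIntegral (β : ℝ) : ℝ :=
  ∫ x in {x : Fin 2 → ℝ | x 0 ≤ β} ∩ unitCube (Fin 2), ((1 + x 0 + x 1) ^ 2)⁻¹

theorem sliceIntegral_eq_sum (hc : 1 < c) {J : ℕ} (hJ : 3 < c ^ J) :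
    sliceIntegral β = ∑ j ∈ Finset.range J,
      ∫ x in geometricSlice β c j ∩ unitCube (Fin 2), ((1 + x 0 + x 1) ^ 2)⁻¹ := by
  rw [sliceIntegral, ← integral_biUnion_finset _
    (fun j _ => (measurableSet_geometricSlice j).inter measurableSet_unitCube)
    (fun i _ j _ hij => (pairwise_disjoint_geometricSlice hc.le hij).mono
      Set.inter_subset_left Set.inter_subset_left)
    (fun j _ => integrableOn_inv_sq_unitCube.mono_set Set.inter_subset_right)]
  congr 2
  ext x
  simp only [Set.mem_inter_iff, Set.mem_iUnion, exists_prop]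
  exact ⟨fun ⟨hxβ, hx⟩ => (exists_mem_geometricSlice hc hJ hx hxβ).imp fun j hj =>
    ⟨hj.1, hj.2, hx⟩, fun ⟨_, _, hxj, hx⟩ => ⟨hxj.1, hx⟩⟩

theorem setIntegral_geometricSlice_le (hc : 0 < c) (j : ℕ) :
    ∫ x in geometricSlice β c j ∩ unitCube (Fin 2), ((1 + x 0 + x 1) ^ 2)⁻¹ ≤
      volume.real (geometricSlice β c j ∩ unitCube (Fin 2)) / (c ^ j) ^ 2 := by
  rw [div_eq_mul_inv, ← smul_eq_mul, ← setIntegral_const]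
  refine setIntegral_mono_on (integrableOn_inv_sq_unitCube.mono_set Set.inter_subset_right)
    ?_ ((measurableSet_geometricSlice j).inter measurableSet_unitCube) fun x hx => ?_
  · exact integrableOn_const (measure_ne_top_of_subset Set.inter_subset_right
      (by simp [volume_unitCube]))
  · have := hx.1.2.1
    gcongr

theorem le_setIntegral_geometricSlice (hc : 0 < c) (j : ℕ) :
    volume.real (geometricSlice β c j ∩ unitCube (Fin 2)) / (c ^ (j + 1)) ^ 2 ≤
      ∫ x in geometricSlice β c j ∩ unitCube (Fin 2), ((1 + x 0 + x 1) ^ 2)⁻¹ := by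
  rw [div_eq_mul_inv, ← smul_eq_mul, ← setIntegral_const]
  refine setIntegral_mono_on ?_ (integrableOn_inv_sq_unitCube.mono_set Set.inter_subset_right)
    ((measurableSet_geometricSlice j).inter measurableSet_unitCube) fun x hx => ?_
  · exact integrableOn_const (measure_ne_top_of_subset Set.inter_subset_right
      (by simp [volume_unitCube]))
  · have : 0 < 1 + x 0 + x 1 := (pow_pos hc j).trans_le hx.1.2.1
    have := hx.1.2.2.le
    gcongr

theorem sum_volume_geometricSlice_div_le (hc : 1 < c) {J : ℕ} (hJ : 3 < c ^ J) :
    ∑ j ∈ Finset.range J, volume.real (geometricSlice β c j ∩ unitCube (Fin 2)) / (c ^ j) ^ 2 ≤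
      c ^ 2 * sliceIntegral β := by
  rw [sliceIntegral_eq_sum hc hJ, Finset.mul_sum]
  gcongr with j
  have hj := le_setIntegral_geometricSlice (β := β) (zero_lt_one.trans hc) j
  rwa [pow_succ c j, mul_pow, ← div_div, div_le_iff₀' (by positivity)] at hj

theorem le_sum_volume_geometricSlice_div (hc : 1 < c) {J : ℕ} (hJ : 3 < c ^ J) :
    sliceIntegral β / c ^ 2 ≤ ∑ j ∈ Finset.range J,
      volume.real (geometricSlice β c j ∩ unitCube (Fin 2)) / (c ^ (j + 1)) ^ 2 := by
  rw [sliceIntegral_eq_sum hc hJ, Finset.sum_div]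
  refine Finset.sum_le_sum fun j _ => ?_
  rw [pow_succ c j, mul_pow, ← div_div]
  gcongr
  exact setIntegral_geometricSlice_le (zero_lt_one.trans hc) j

theorem eventually_card_hyperbolicPairs_div_sq_lt (hc : 1 < c) {a : ℝ}
    (ha : 3 / Real.pi ^ 2 * (c ^ 2 * sliceIntegral β) < a) :
    ∀ᶠ Q : ℕ in atTop, ((hyperbolicPairs β Q).card : ℝ) / (Q : ℝ) ^ 2 < a := by
  classical
  obtain ⟨J, hJ⟩ := pow_unbounded_of_one_lt (3 : ℝ) hc
  have hlim := tendsto_finsetSum (Finset.range J) fun j _ =>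
    tendsto_card_filter_floor_inversePoint_mem_div_sq (measurableSet_geometricSlice j)
      (volume_frontier_geometricSlice (β := β) (c := c) j) (c := c ^ j) (by positivity)
  rw [← Finset.mul_sum] at hlim
  have hlt := (mul_le_mul_of_nonneg_left (sum_volume_geometricSlice_div_le hc hJ)
    (by positivity)).trans_lt ha
  filter_upwards [hlim.eventually_lt_const hlt] with Q hQ
  refine lt_of_le_of_lt ?_ hQ
  rw [← Finset.sum_div]
  gcongr
  exact_mod_cast card_hyperbolicPairs_le Q hc hJ

theorem eventually_lt_card_hyperbolicPairs_div_sq (hc : 1 < c) {a : ℝ}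
    (ha : a < 3 / Real.pi ^ 2 * (sliceIntegral β / c ^ 2)) :
    ∀ᶠ Q : ℕ in atTop, a < ((hyperbolicPairs β Q).card : ℝ) / (Q : ℝ) ^ 2 := by
  classical
  obtain ⟨J, hJ⟩ := pow_unbounded_of_one_lt (3 : ℝ) hc
  have hlim := tendsto_finsetSum (Finset.range J) fun j _ =>
    tendsto_card_filter_floor_inversePoint_mem_div_sq (measurableSet_geometricSlice j)
      (volume_frontier_geometricSlice (β := β) (c := c) j) (c := c ^ (j + 1)) (by positivity)
  rw [← Finset.mul_sum] at hlim
  have hlt := ha.trans_le (mul_le_mul_of_nonneg_left (le_sum_volume_geometricSlice_div hc hJ)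
    (by positivity))
  filter_upwards [hlim.eventually_const_lt hlt] with Q hQ
  refine hQ.trans_le ?_
  rw [← Finset.sum_div]
  gcongr
  exact_mod_cast le_card_hyperbolicPairs Q hc.le J

theorem tendsto_card_hyperbolicPairs_div_sq (β : ℝ) :
    Tendsto (fun Q : ℕ => ((hyperbolicPairs β Q).card : ℝ) / (Q : ℝ) ^ 2) atTop
      (𝓝 (3 / Real.pi ^ 2 * sliceIntegral β)) := by
  have hlower : Tendsto (fun c : ℝ => 3 / Real.pi ^ 2 * (sliceIntegral β / c ^ 2)) (𝓝[>] 1)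
      (𝓝 (3 / Real.pi ^ 2 * sliceIntegral β)) := by
    have : ContinuousAt (fun c : ℝ => 3 / Real.pi ^ 2 * (sliceIntegral β / c ^ 2)) 1 := by
      fun_prop (disch := norm_num)
    simpa using this.tendsto.mono_left nhdsWithin_le_nhds
  have hupper : Tendsto (fun c : ℝ => 3 / Real.pi ^ 2 * (c ^ 2 * sliceIntegral β)) (𝓝[>] 1)
      (𝓝 (3 / Real.pi ^ 2 * sliceIntegral β)) := by
    have : Continuous fun c : ℝ => 3 / Real.pi ^ 2 * (c ^ 2 * sliceIntegral β) := by fun_prop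
    simpa using (this.tendsto 1).mono_left nhdsWithin_le_nhds
  refine tendsto_order.2 ⟨fun a ha => ?_, fun a ha => ?_⟩
  · obtain ⟨c, hca, hc⟩ := ((hlower.eventually_const_lt ha).and self_mem_nhdsWithin).exists
    exact eventually_lt_card_hyperbolicPairs_div_sq hc hca
  · obtain ⟨c, hca, hc⟩ := ((hupper.eventually_lt_const ha).and self_mem_nhdsWithin).exists
    exact eventually_card_hyperbolicPairs_div_sq_lt hc hca

end Slicing

section Integral

open MeasureTheory

theorem integral_inv_add_sq {a : ℝ} (ha : 0 < a) :
    ∫ y in (0 : ℝ)..1, ((a + y) ^ 2)⁻¹ = 1 / a - 1 / (a + 1) := by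
  have hne (y : ℝ) (hy : y ∈ Set.uIcc 0 1) : a + y ≠ 0 := by
    rw [Set.uIcc_of_le zero_le_one] at hy
    linarith [hy.1]
  have hderiv (y : ℝ) (hy : y ∈ Set.uIcc 0 1) :
      HasDerivAt (fun y => -(a + y)⁻¹) ((a + y) ^ 2)⁻¹ y :=
    (((hasDerivAt_id' y).const_add a).inv (hne y hy)).neg.congr_deriv (by rw [neg_div]; simp)
  rw [intervalIntegral.integral_eq_sub_of_hasDerivAt hderiv]
  · simp only [add_zero, one_div]
    ring
  · exact (ContinuousOn.inv₀ (by fun_prop) fun y hy =>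
      pow_ne_zero 2 (hne y hy)).intervalIntegrable

theorem sliceIntegral_eq {β : ℝ} (hβ : β ∈ Set.Icc (0 : ℝ) 1) :
    sliceIntegral β = ∫ x in (0 : ℝ)..β, (1 / (1 + x) - 1 / (2 + x)) := by
  have hprod := volume_preserving_finTwoArrow ℝ
  have hset : {x : Fin 2 → ℝ | x 0 ≤ β} ∩ unitCube (Fin 2) =
      MeasurableEquiv.finTwoArrow ⁻¹' (Set.Ioc 0 β ×ˢ Set.Ioc (0 : ℝ) 1) := by
    ext x
    simp only [unitCube, Set.mem_inter_iff, Set.mem_ofPred_eq, Set.mem_univ_pi, Set.mem_Ioc,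
      Fin.forall_fin_two, MeasurableEquiv.finTwoArrow_apply, Set.mem_preimage, Set.mem_prod]
    grind
  have hint : IntegrableOn (fun z : ℝ × ℝ => ((1 + z.1 + z.2) ^ 2)⁻¹)
      (Set.Ioc 0 β ×ˢ Set.Ioc (0 : ℝ) 1) :=
    (hprod.integrableOn_comp_preimage (MeasurableEquiv.measurableEmbedding _)).1
      (integrableOn_inv_sq_unitCube.mono_set (hset ▸ Set.inter_subset_right))
  calc sliceIntegral β
      = ∫ z in Set.Ioc 0 β ×ˢ Set.Ioc (0 : ℝ) 1, ((1 + z.1 + z.2) ^ 2)⁻¹ := by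
        rw [sliceIntegral, hset]
        exact hprod.setIntegral_preimage_emb (MeasurableEquiv.measurableEmbedding _)
          (fun z : ℝ × ℝ => ((1 + z.1 + z.2) ^ 2)⁻¹) _
    _ = ∫ x in Set.Ioc 0 β, ∫ y in Set.Ioc (0 : ℝ) 1, ((1 + x + y) ^ 2)⁻¹ :=
        setIntegral_prod _ hint
    _ = ∫ x in Set.Ioc 0 β, (1 / (1 + x) - 1 / (2 + x)) := by
        refine setIntegral_congr_fun measurableSet_Ioc fun x hx => ?_
        rw [← intervalIntegral.integral_of_le zero_le_one,
          integral_inv_add_sq (add_pos one_pos hx.1), add_right_comm, one_add_one_eq_two]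
    _ = ∫ x in (0 : ℝ)..β, (1 / (1 + x) - 1 / (2 + x)) :=
        (intervalIntegral.integral_of_le hβ.1).symm

theorem sliceIntegral_one : sliceIntegral 1 = Real.log (4 / 3) := by
  have hne (a : ℝ) (ha : 0 < a) (x : ℝ) (hx : x ∈ Set.uIcc 0 1) : a + x ≠ 0 := by
    rw [Set.uIcc_of_le zero_le_one] at hx
    linarith [hx.1]
  have hint (a : ℝ) (ha : 0 < a) : IntervalIntegrable (fun x => 1 / (a + x)) volume 0 1 :=
    (ContinuousOn.div (by fun_prop) (by fun_prop) (hne a ha)).intervalIntegrable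
  have hlog (a : ℝ) (ha : 0 < a) :
      ∫ x in (0 : ℝ)..1, 1 / (a + x) = Real.log ((a + 1) / a) := by
    rw [intervalIntegral.integral_comp_add_left (fun x => 1 / x),
      integral_one_div_of_pos (by linarith) (by linarith), add_zero]
  rw [sliceIntegral_eq (by simp), intervalIntegral.integral_sub (hint 1 one_pos) (hint 2 two_pos),
    hlog 1 one_pos, hlog 2 two_pos, ← Real.log_div (by norm_num) (by norm_num)]
  norm_num

end Integral

section SaturatedFarey

theorem exists_coprimePairs_of_mem_saturatedFarey {Q : ℕ} {x : ℚ} (hx : x ∈ saturatedFarey Q) :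
    ∃ p ∈ coprimePairs Q, p.1 + p.2 + posRep (p.2 : ZMod p.1)⁻¹ ≤ Q ∧ (p.2 : ℚ) / p.1 = x := by
  obtain ⟨M, ⟨⟨hba, hdb, hd, -, hdc⟩, htrace⟩, rfl⟩ := hx
  have hdet := M.2
  rw [Matrix.trace_fin_two] at htrace
  rw [Matrix.det_fin_two] at hdet
  unfold fracPsi
  generalize M.1 0 0 = a at *
  generalize M.1 0 1 = b at *
  generalize M.1 1 0 = c at *
  generalize M.1 1 1 = d at *
  lift b to ℕ using by omega
  lift d to ℕ using by omega
  obtain ⟨k, rfl⟩ : ∃ k : ℕ, a = b + k := ⟨(a - b).toNat, by omega⟩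
  have hcop : b.Coprime d := Nat.isCoprime_iff_coprime.1 ⟨-c, b + k, by linarith⟩
  have hinv : (k : ZMod b) * d = 1 := by
    simpa using congrArg (Int.cast : ℤ → ZMod b) hdet
  have hk : 0 < k := by
    by_contra! h
    obtain rfl : k = 0 := by omega
    rw [Nat.cast_zero, add_zero] at hdet
    nlinarith [mul_le_mul_of_nonneg_left hdc (Int.natCast_nonneg b)]
  have hrep := posRep_inv_natCast_le hk hinv
  refine ⟨⟨b, d⟩, mem_coprimePairs.2 ⟨?_, ?_, ?_, hcop⟩, ?_, by simp⟩ <;> dsimp only <;> omega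

theorem div_mem_saturatedFarey {Q : ℕ} {p : (_ : ℕ) × ℕ} (hp : p ∈ coprimePairs Q)
    (hpQ : p.1 + p.2 + posRep (p.2 : ZMod p.1)⁻¹ ≤ Q) : (p.2 : ℚ) / p.1 ∈ saturatedFarey Q := by
  obtain ⟨b, d⟩ := p
  obtain ⟨-, hd, hdb, hcop⟩ := mem_coprimePairs.1 hp
  dsimp only at hpQ hd hdb hcop ⊢
  have : NeZero b := ⟨by omega⟩
  obtain ⟨hk, hkb⟩ := Finset.mem_Ioc.1 (posRep_mem_Ioc (d : ZMod b)⁻¹)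
  set k := posRep (d : ZMod b)⁻¹ with hk_def
  obtain ⟨c, hc⟩ : (b : ℤ) ∣ (b + k) * d - 1 := by
    rw [← ZMod.intCast_zmod_eq_zero_iff_dvd]
    push_cast
    rw [hk_def, natCast_posRep, ZMod.natCast_self, zero_add, mul_comm,
      ZMod.coe_mul_inv_eq_one d hcop.symm, sub_self]
  have hb : (0 : ℤ) < b := by omega
  have hkd : (1 : ℤ) ≤ k * d := by exact_mod_cast Nat.mul_le_mul hk hd
  have hca : c ≤ b + k := le_of_mul_le_mul_left (by nlinarith) hb
  have hdc : (d : ℤ) ≤ c := le_of_mul_le_mul_left (by linarith) hb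
  refine ⟨⟨!![(b : ℤ) + k, b; c, d], by rw [Matrix.det_fin_two_of]; linarith⟩,
    ⟨⟨?_, ?_, ?_, hca, hdc⟩, ?_⟩, ?_⟩
  · simp
  · simpa using hdb
  · simpa using Nat.succ_le_of_lt hd
  · rw [Matrix.trace_fin_two]
    change (b : ℤ) + k + d ≤ Q
    omega
  · simp [fracPsi]

theorem injOn_div_coprimePairs (Q : ℕ) :
    Set.InjOn (fun p : (_ : ℕ) × ℕ => (p.2 : ℚ) / p.1) (coprimePairs Q) := by
  rintro ⟨b, d⟩ hp ⟨b', d'⟩ hp' h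
  obtain ⟨-, hd, hdb, hcop⟩ := mem_coprimePairs.1 hp
  obtain ⟨-, hd', hdb', hcop'⟩ := mem_coprimePairs.1 hp'
  have hint := Rat.div_int_inj (a := d) (b := b) (c := d') (d := b') (by dsimp only at *; omega)
    (by dsimp only at *; omega) (by simpa using hcop.symm) (by simpa using hcop'.symm)
    (by simpa using h)
  obtain rfl : b = b' := by exact_mod_cast hint.2
  obtain rfl : d = d' := by exact_mod_cast hint.1
  rfl

theorem saturatedFarey_inter_Icc_eq_image (β : ℝ) (Q : ℕ) :
    {x ∈ saturatedFarey Q | (x : ℝ) ∈ Set.Icc (0 : ℝ) β} =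
      (fun p : (_ : ℕ) × ℕ => (p.2 : ℚ) / p.1) '' hyperbolicPairs β Q := by
  ext x
  constructor
  · rintro ⟨hx, hxβ⟩
    obtain ⟨p, hp, hpQ, rfl⟩ := exists_coprimePairs_of_mem_saturatedFarey hx
    exact ⟨p, Finset.mem_filter.2 ⟨hp, hpQ, by simpa using hxβ.2⟩, rfl⟩
  · rintro ⟨p, hp, rfl⟩
    obtain ⟨hp, hpQ, hpβ⟩ := Finset.mem_filter.1 hp
    refine ⟨div_mem_saturatedFarey hp hpQ, ?_, by simpa using hpβ⟩
    push_cast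
    positivity

theorem ncard_saturatedFarey_inter_Icc (β : ℝ) (Q : ℕ) :
    {x ∈ saturatedFarey Q | (x : ℝ) ∈ Set.Icc (0 : ℝ) β}.ncard = (hyperbolicPairs β Q).card := by
  have hinj := (injOn_div_coprimePairs Q).mono (s₁ := hyperbolicPairs β Q)
    (Finset.coe_subset.2 (Finset.filter_subset _ _))
  rw [saturatedFarey_inter_Icc_eq_image, hinj.ncard_image, Set.ncard_coe_finset]

theorem saturatedFarey_inter_Icc_zero_one (Q : ℕ) :
    {x ∈ saturatedFarey Q | (x : ℝ) ∈ Set.Icc (0 : ℝ) 1} = saturatedFarey Q := by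
  refine Set.sep_eq_self_iff_mem_true.2 ?_
  rintro _ ⟨M, ⟨⟨-, hdb, hd, -, -⟩, -⟩, rfl⟩
  have hd : (1 : ℝ) ≤ M.1 1 1 := by exact_mod_cast hd
  have hdb : (M.1 1 1 : ℝ) ≤ M.1 0 1 := by exact_mod_cast hdb
  simp only [fracPsi, Rat.cast_div, Rat.cast_intCast]
  exact ⟨div_nonneg (by linarith) (by linarith), (div_le_one (by linarith)).2 hdb⟩

theorem tendsto_ncard_saturatedFarey_div_sq (β : ℝ) :
    Tendsto (fun Q : ℕ =>
      ({x ∈ saturatedFarey Q | (x : ℝ) ∈ Set.Icc (0 : ℝ) β}.ncard : ℝ) / (Q : ℝ) ^ 2) atTop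
      (𝓝 (3 / Real.pi ^ 2 * sliceIntegral β)) := by
  simpa only [ncard_saturatedFarey_inter_Icc] using tendsto_card_hyperbolicPairs_div_sq β

end SaturatedFarey

theorem corollary3 (β : ℝ) (hβ : β ∈ Set.Icc (0 : ℝ) 1) :
    Tendsto
      (fun Q : ℕ =>
        (({x ∈ saturatedFarey Q | (x : ℝ) ∈ Set.Icc (0 : ℝ) β}.ncard : ℕ) : ℝ) /
          ((saturatedFarey Q).ncard : ℝ))
      atTop
      (𝓝 (∫ x in (0 : ℝ)..β, (1 / (1 + x) - 1 / (2 + x)) / Real.log (4 / 3))) := by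
  have hlog : Real.log (4 / 3) ≠ 0 := (Real.log_pos (by norm_num)).ne'
  have hconst : 3 / Real.pi ^ 2 ≠ 0 := by positivity
  have htotal := tendsto_ncard_saturatedFarey_div_sq 1
  simp only [saturatedFarey_inter_Icc_zero_one, sliceIntegral_one] at htotal
  have hratio := (tendsto_ncard_saturatedFarey_div_sq β).div htotal (mul_ne_zero hconst hlog)
  rw [mul_div_mul_left _ _ hconst, sliceIntegral_eq hβ, ← intervalIntegral.integral_div] at hratio
  refine hratio.congr' ?_
  filter_upwards [eventually_gt_atTop 0] with Q hQ
  exact div_div_div_cancel_right₀ (by positivity) _ _
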